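/- Let $\mathbb{K}$ be an algebraically closed field of characteristic $0$. All varieties are irreducible; a subvariety of $\mathbb{P}^n=\mathbb{P}^n_{\mathbb K}$ is an irreducible Zariski closed subset. For a subvariety $X\subseteq\mathbb{P}^n$ let $I(X)$ be its homogeneous vanishing ideal, and let $HF_X(m)=\dim_{\mathbb K}\big(\mathbb{K}[x_0,\dots,x_n]/I(X)\big)_m$ be the Hilbert function of its homogeneous coordinate ring. The dimension of $X$ is its Krull dimension in the Zariski topology, and its degree is $r!$ times the leading coefficient of its Hilbert polynomial, where $r$ is the degree of that polynomial. The Hadamard product $X_1\odot\cdots\odot X_\ell\subseteq\mathbb{P}^n$ is the Zariski closure of the set of all coordinatewise products $P_1\odot\cdots\odot P_\ell$ of points $P_i\in X_i$, taken whenever the coordinatewise product is not the zero vector. Let $\ell\ge 1$, $n\ge 0$ and $h_1,\dots,h_\ell\ge 0$ be integers with $n\ge (h_1+1)\cdots(h_\ell+1)-1$, and let $L_1,\dots,L_\ell$ be generic linear subspaces of $\mathbb{P}^n$ of dimensions $h_1,\dots,h_\ell$; that is, $(L_1,\dots,L_\ell)$ is any element of a suitable non-empty Zariski open subset, depending only on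 $\mathbb K,n,h_1,\dots,h_\ell$, of the product of the Grassmannians of $h_i$-dimensional linear subspaces of $\mathbb{P}^n$. For each $i=1,\dots,\ell$ let $X_i$ be a subvariety of $\mathbb{P}^n$ contained in $L_i$, of dimension $r_i$ and degree $d_i$. Then (i) $\dim(X_1\odot\cdots\odot X_\ell)=r_1+\cdots+r_\ell$; (ii) $\deg(X_1\odot\cdots\odot X_\ell)=\dfrac{(r_1+\cdots+r_\ell)!}{r_1!\cdots r_\ell!}\,\prod_{i=1}^{\ell} d_i$; (iii) $HF_{X_1\odot\cdots\odot X_\ell}(m)=\prod_{i=1}^{\ell}HF_{X_i}(m)$ for all integers $m\ge 0$. -/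

import Mathlib

namespace HadamardVarieties

open MvPolynomial

/-- The projective space of dimension `n` over `K`, as the set of lines in `K^(n+1)`. -/
abbrev PP (K : Type*) [Field K] (n : ℕ) : Type _ := Projectivization K (Fin (n + 1) → K)

/-- The common zeros of the polynomials in `S`. It is used for sets `S` of homogeneous polynomials,
for which the choice of representatives of the points does not matter. -/
def zeroLocus {K : Type*} [Field K] {n : ℕ} (S : Set (MvPolynomial (Fin (n + 1)) K)) :
    Set (PP K n) :=
  {p | ∀ f ∈ S, eval p.rep f = 0}

/-- A set of polynomials all of whose members are homogeneous (of possibly different degrees). -/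
def HomogeneousSet {K : Type*} [Field K] {n : ℕ} (S : Set (MvPolynomial (Fin (n + 1)) K)) : Prop :=
  ∀ f ∈ S, ∃ d : ℕ, f.IsHomogeneous d

/-- The Zariski topology on projective space: the closed sets are the zero loci of sets of
homogeneous polynomials. -/
instance zariskiTopology (K : Type*) [Field K] (n : ℕ) : TopologicalSpace (PP K n) :=
  TopologicalSpace.ofClosed {Z | ∃ S, HomogeneousSet S ∧ Z = zeroLocus S}
    (by
      refine ⟨{1}, ?_, ?_⟩
      · rintro f rfl
        exact ⟨0, isHomogeneous_one _ _⟩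
      · ext p
        simp [zeroLocus])
    (by
      intro A hA
      have hA' : ∀ Z ∈ A, ∃ S : Set (MvPolynomial (Fin (n + 1)) K),
          HomogeneousSet S ∧ Z = zeroLocus S := fun Z hZA => hA hZA
      choose! S hS hZ using hA'
      refine ⟨⋃ Z ∈ A, S Z, ?_, ?_⟩
      · intro f hf
        simp only [Set.mem_iUnion] at hf
        obtain ⟨Z, hZA, hfZ⟩ := hf
        exact hS Z hZA f hfZ
      · ext p
        simp only [Set.mem_sInter, zeroLocus, Set.mem_iUnion, Set.mem_ofPred_eq]
        constructor
        · rintro h f ⟨Z, hZA, hfZ⟩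
          have hp := h Z hZA
          rw [hZ Z hZA] at hp
          exact hp f hfZ
        · intro h Z hZA
          rw [hZ Z hZA]
          exact fun f hf => h f ⟨Z, hZA, hf⟩)
    (by
      rintro _ ⟨S, hS, rfl⟩ _ ⟨T, hT, rfl⟩
      refine ⟨{h | ∃ f ∈ S, ∃ g ∈ T, h = f * g}, ?_, ?_⟩
      · rintro _ ⟨f, hf, g, hg, rfl⟩
        obtain ⟨a, ha⟩ := hS f hf
        obtain ⟨b, hb⟩ := hT g hg
        exact ⟨a + b, ha.mul hb⟩
      · ext p
        simp only [Set.mem_union, zeroLocus, Set.mem_ofPred_eq]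
        constructor
        · rintro (h | h) _ ⟨f, hf, g, hg, rfl⟩
          · simp [h f hf]
          · simp [h g hg]
        · intro h
          by_contra hcon
          push Not at hcon
          obtain ⟨⟨f, hf, hf0⟩, g, hg, hg0⟩ := hcon
          have := h _ ⟨f, hf, g, hg, rfl⟩
          rw [map_mul] at this
          exact (mul_ne_zero hf0 hg0) this)

/-- A (projective) subvariety of projective space: a Zariski closed irreducible subset
(in particular it is non-empty). -/
def IsSubvariety {K : Type*} [Field K] {n : ℕ} (X : Set (PP K n)) : Prop :=
  IsClosed X ∧ IsIrreducible X

/-- The homogeneous vanishing ideal `I(X)`, generated by all homogeneous polynomials vanishing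
at every point of `X`. -/
noncomputable def vanishingIdeal {K : Type*} [Field K] {n : ℕ} (X : Set (PP K n)) :
    Ideal (MvPolynomial (Fin (n + 1)) K) :=
  Ideal.span {f | (∃ d : ℕ, f.IsHomogeneous d) ∧ ∀ p ∈ X, eval p.rep f = 0}

/-- The homogeneous coordinate ring `K[x_0, …, x_n] / I(X)`. -/
abbrev CoordinateRing {K : Type*} [Field K] {n : ℕ} (X : Set (PP K n)) : Type _ :=
  MvPolynomial (Fin (n + 1)) K ⧸ vanishingIdeal X

/-- The degree `m` part of the homogeneous coordinate ring: the classes of the homogeneous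
polynomials of degree `m`. -/
noncomputable def coordinateRingPart {K : Type*} [Field K] {n : ℕ} (X : Set (PP K n)) (m : ℕ) :
    Submodule K (CoordinateRing X) :=
  (homogeneousSubmodule (Fin (n + 1)) K m).map
    (Ideal.Quotient.mkₐ K (vanishingIdeal X)).toLinearMap

/-- The Hilbert function `HF_X` of (the homogeneous coordinate ring of) `X`. -/
noncomputable def hilbertFunction {K : Type*} [Field K] {n : ℕ} (X : Set (PP K n)) (m : ℕ) : ℕ :=
  Module.finrank K (coordinateRingPart X m)

open Classical in
/-- The Hilbert polynomial of `X`: the (unique) polynomial with rational coefficients which agrees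
with the Hilbert function in all large degrees. -/
noncomputable def hilbertPolynomial {K : Type*} [Field K] {n : ℕ} (X : Set (PP K n)) :
    Polynomial ℚ :=
  if h : ∃ P : Polynomial ℚ, ∃ m₀ : ℕ, ∀ m ≥ m₀, P.eval (m : ℚ) = (hilbertFunction X m : ℚ)
  then h.choose else 0

/-- The degree of `X`: if the Hilbert polynomial has degree `r`, its leading coefficient
times `r!`. -/
noncomputable def degree {K : Type*} [Field K] {n : ℕ} (X : Set (PP K n)) : ℚ :=
  (hilbertPolynomial X).leadingCoeff * ((hilbertPolynomial X).natDegree.factorial : ℚ)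

/-- The dimension of `X`, as a topological space with the Zariski topology. -/
noncomputable def dim {K : Type*} [Field K] {n : ℕ} (X : Set (PP K n)) : WithBot ℕ∞ :=
  topologicalKrullDim X

/-- The Hadamard product `X_1 ⊙ ⋯ ⊙ X_ℓ`: the Zariski closure of the set of all coordinatewise
products of points `P_i ∈ X_i`, whenever such a product is defined (i.e. is not the zero vector). -/
def hadamardProduct {K : Type*} [Field K] {n ℓ : ℕ} (X : Fin ℓ → Set (PP K n)) : Set (PP K n) :=
  closure {Q | ∃ P : Fin ℓ → PP K n, (∀ i, P i ∈ X i) ∧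
    ∃ hne : (fun j => ∏ i, (P i).rep j) ≠ 0,
      Q = Projectivization.mk K (fun j => ∏ i, (P i).rep j) hne}

/-- Tuples `(L_1, …, L_ℓ)` of linear subspaces of `ℙ^n` of projective dimensions `h_1, …, h_ℓ`,
i.e. points of a product of Grassmannians. A linear subspace of projective dimension `h` is given
by the corresponding vector subspace of dimension `h + 1`. -/
def LinearSubspaces (K : Type*) [Field K] (n : ℕ) {ℓ : ℕ} (h : Fin ℓ → ℕ) : Type _ :=
  ∀ i, {W : Submodule K (Fin (n + 1) → K) // Module.finrank K W = h i + 1}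

/-- The linear subspace of `ℙ^n` determined by the `i`-th member of the tuple. -/
def LinearSubspaces.toSet {K : Type*} [Field K] {n ℓ : ℕ} {h : Fin ℓ → ℕ}
    (L : LinearSubspaces K n h) (i : Fin ℓ) : Set (PP K n) :=
  {p | p.submodule ≤ (L i).1}

/-- `A` is a parameterization of `L`: for each `i` the vectors `A i 0, …, A i (h i)` are a basis of
the vector subspace of `K^(n+1)` corresponding to `L i`. -/
def IsParameterization {K : Type*} [Field K] {n ℓ : ℕ} {h : Fin ℓ → ℕ}
    (A : ∀ i, Fin (h i + 1) → Fin (n + 1) → K) (L : LinearSubspaces K n h) : Prop :=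
  ∀ i, LinearIndependent K (A i) ∧ Submodule.span K (Set.range (A i)) = (L i).1

/-- Zariski open subsets of the product of Grassmannians, with its description as a quotient of the
space of parameterizations: `U` is open if the parameterizations of the members of `U` are the
complement, among all parameterizations, of the zero set of some polynomials in the entries of the
parameterizations. -/
def IsZariskiOpen {K : Type*} [Field K] {n ℓ : ℕ} {h : Fin ℓ → ℕ}
    (U : Set (LinearSubspaces K n h)) : Prop :=
  ∃ S : Set (MvPolynomial (Σ i : Fin ℓ, Fin (h i + 1) × Fin (n + 1)) K),
    ∀ (L : LinearSubspaces K n h) (A : ∀ i, Fin (h i + 1) → Fin (n + 1) → K),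
      IsParameterization A L →
        (L ∈ U ↔ ∃ f ∈ S, eval (fun q => A q.1 q.2.1 q.2.2) f ≠ 0)

/-- A property holds for generic linear subspaces `L_1, …, L_ℓ` of `ℙ^n` of dimensions
`h_1, …, h_ℓ` if it holds for all members of a non-empty Zariski open set of such tuples
(which is dense, products of Grassmannians being irreducible). -/
def ForGenericSubspaces {K : Type*} [Field K] {n ℓ : ℕ} {h : Fin ℓ → ℕ}
    (p : LinearSubspaces K n h → Prop) : Prop :=
  ∃ U : Set (LinearSubspaces K n h), IsZariskiOpen U ∧ U.Nonempty ∧ ∀ L ∈ U, p L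

end HadamardVarieties

/-!
Each `L_i` is spanned by vectors `A_{i,0}, …, A_{i,h_i}`, and for generic `L_i` the coordinatewise
products `A_{1,a_1} ⋯ A_{ℓ,a_ℓ}` are linearly independent; one non-vanishing minor is enough, and
suitable 0-1 vectors provide it as soon as `n + 1 ≥ ∏ (h_i + 1)`. The Hadamard product restricted
to `L_1 × ⋯ × L_ℓ` is then the Segre embedding followed by a linear embedding.

The degree `m` part of the coordinate ring of `X` is the `m`-th power of the space of functions
on `X` spanned by the coordinates. For `X_1 ⊙ ⋯ ⊙ X_ℓ` that space, pulled back to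
`X_1 × ⋯ × X_ℓ`, consists of the sums of products of linear forms in the separate variables,
so its powers have dimension equal to the product of the dimensions of the factors. This
is the formula for Hilbert functions. Hilbert polynomials are multiplied as well, and the
degree of the Hilbert polynomial is the dimension: this follows by noetherian induction on a
homogeneous ideal `I` from the exact sequences `0 → S/(I : f)(-e) → S/I → S/(I + f) → 0`.
-/

namespace HadamardVarieties

open Filter

section LinearAlgebra

variable {K V W W' : Type*} [Field K] [AddCommGroup V] [Module K V] [AddCommGroup W] [Module K W]
  [AddCommGroup W'] [Module K W']

lemma finrank_map_eq_of_forall_eq_zero_iff (p : Submodule K V) (φ : V →ₗ[K] W) (ψ : V →ₗ[K] W')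
    (h : ∀ x ∈ p, φ x = 0 ↔ ψ x = 0) :
    Module.finrank K (p.map φ) = Module.finrank K (p.map ψ) := by
  have hker : (φ.domRestrict p).ker = (ψ.domRestrict p).ker := by
    ext x
    exact h x x.2
  rw [← LinearMap.range_domRestrict, ← LinearMap.range_domRestrict,
    ← (φ.domRestrict p).quotKerEquivRange.finrank_eq,
    ← (ψ.domRestrict p).quotKerEquivRange.finrank_eq, hker]

lemma finrank_map_add_finrank_inf_ker (p : Submodule K V) [FiniteDimensional K p]
    (φ : V →ₗ[K] W) :
    Module.finrank K (p.map φ) + Module.finrank K (p ⊓ φ.ker : Submodule K V) =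
      Module.finrank K p := by
  rw [← LinearMap.finrank_range_add_finrank_ker (φ.domRestrict p), LinearMap.range_domRestrict,
    LinearMap.ker_domRestrict, ← Submodule.finrank_map_subtype_eq, Submodule.map_comap_subtype]

lemma finrank_map_add_finrank_map_inf_ker (p : Submodule K V) [FiniteDimensional K p]
    {φ : V →ₗ[K] W} {ψ : V →ₗ[K] W'} (h : φ.ker ≤ ψ.ker) :
    Module.finrank K (p.map ψ) + Module.finrank K ((p ⊓ ψ.ker).map φ : Submodule K W) =
      Module.finrank K (p.map φ) := by
  have hp := finrank_map_add_finrank_inf_ker p φ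
  have hq := finrank_map_add_finrank_inf_ker (p ⊓ ψ.ker) φ
  rw [inf_assoc, inf_eq_right.2 h] at hq
  rw [← finrank_map_add_finrank_inf_ker p ψ] at hp
  omega

end LinearAlgebra

section HomogeneousIdeals

variable {A : Type*} [CommRing A] {I : Ideal A} {f : A}

lemma lt_sup_span_singleton (hf : f ∉ I) : I < I ⊔ Ideal.span {f} := by
  simpa using hf

lemma colon_singleton_eq_self [I.IsPrime] (hf : f ∉ I) : Submodule.colon I {f} = I :=
  le_antisymm (fun _ hg => ((Ideal.IsPrime.mem_or_mem ‹_›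
    (Submodule.mem_colon_singleton.1 hg)).resolve_right hf)) Ideal.le_colon

variable {σ : Type*} [SetLike σ A] [AddSubmonoidClass σ A] {𝒜 : ℕ → σ} [GradedRing 𝒜] {e : ℕ}

lemma isHomogeneous_sup_span_singleton (hI : I.IsHomogeneous 𝒜) (hf : f ∈ 𝒜 e) :
    (I ⊔ Ideal.span {f}).IsHomogeneous 𝒜 :=
  hI.sup (Ideal.homogeneous_span _ _ (by rintro _ rfl; exact ⟨e, hf⟩))

lemma isHomogeneous_colon_singleton (hI : I.IsHomogeneous 𝒜) (hf : f ∈ 𝒜 e) :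
    (Submodule.colon I {f}).IsHomogeneous 𝒜 := by
  intro i g hg
  rw [Submodule.mem_colon_singleton, smul_eq_mul] at hg ⊢
  rw [← DirectSum.coe_decompose_mul_add_of_right_mem 𝒜 hf]
  exact hI (i + e) hg

lemma exists_sub_mul_mem_of_mem_sup_span_singleton (hI : I.IsHomogeneous 𝒜) (hf : f ∈ 𝒜 e) {m : ℕ}
    {g : A} (hg : g ∈ 𝒜 (m + e)) (h : g ∈ I ⊔ Ideal.span {f}) :
    ∃ b ∈ 𝒜 m, g - b * f ∈ I := by
  obtain ⟨a, ha, c, hc, rfl⟩ := Submodule.mem_sup.1 h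
  obtain ⟨b, rfl⟩ := Ideal.mem_span_singleton'.1 hc
  refine ⟨DirectSum.decompose 𝒜 b m, SetLike.coe_mem _, ?_⟩
  rw [← DirectSum.coe_decompose_mul_add_of_right_mem 𝒜 hf]
  nth_rw 1 [← DirectSum.decompose_of_mem_same 𝒜 hg]
  rw [DirectSum.decompose_add, DirectSum.add_apply, AddMemClass.coe_add, add_sub_cancel_right]
  exact hI (m + e) ha

theorem homogeneousIdeal_induction [IsNoetherianRing A] {C : Ideal A → Prop} (top : C ⊤)
    (prime : ∀ I : Ideal A, I.IsPrime → I.IsHomogeneous 𝒜 →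
      (∀ J > I, J.IsHomogeneous 𝒜 → C J) → C I)
    (cut : ∀ I : Ideal A, I.IsHomogeneous 𝒜 → ∀ (e : ℕ) (f : A), f ∈ 𝒜 e →
      C (I ⊔ Ideal.span {f}) → C (Submodule.colon I {f}) → C I)
    (I : Ideal A) (hI : I.IsHomogeneous 𝒜) : C I := by
  induction I using WellFoundedGT.induction with
  | _ I ih =>
  by_cases hprime : I.IsPrime
  · exact prime I hprime hI fun J hJ => ih J hJ
  obtain rfl | hne := eq_or_ne I ⊤
  · exact top
  obtain ⟨f, g, e, hg, hfg, hfI, hgI⟩ : ∃ f g e, g ∈ 𝒜 e ∧ f * g ∈ I ∧ f ∉ I ∧ g ∉ I := by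
    by_contra! hcon
    refine hprime (hI.isPrime_of_homogeneous_mem_or_mem hne ?_)
    rintro x y - ⟨e, hy⟩ hxy
    exact or_iff_not_imp_left.2 fun hx => hcon x y e hy hxy hx
  refine cut I hI e g hg (ih _ (lt_sup_span_singleton hgI) (isHomogeneous_sup_span_singleton hI hg))
    (ih _ (Ideal.le_colon.lt_of_not_ge fun h => hfI ?_) (isHomogeneous_colon_singleton hI hg))
  exact h (Submodule.mem_colon_singleton.2 hfg)

end HomogeneousIdeals

section RationalPolynomials

open Polynomial

lemma exists_taylor_one_sub_eq (Q : ℚ[X]) : ∃ R : ℚ[X], taylor 1 R - R = Q := by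
  refine ⟨∑ i ∈ Q.support, C (Q.coeff i / (i + 1)) * Polynomial.bernoulli (i + 1),
    Polynomial.funext fun x => ?_⟩
  rw [eval_sub, taylor_eval, eval_finsetSum, eval_finsetSum, ← Finset.sum_sub_distrib,
    eval_eq_sum, Polynomial.sum]
  refine Finset.sum_congr rfl fun i _ => ?_
  rw [eval_mul, eval_mul, eval_C, eval_C, add_comm x, bernoulli_eval_one_add]
  have : (i + 1 : ℚ) ≠ 0 := by positivity
  push_cast
  field_simp
  ring

lemma degree_taylor_sub_lt {F : Type*} [CommRing F] {R : F[X]} (hR : R ≠ 0) (e : F) :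
    (taylor e R - R).degree < R.degree := by
  rw [← degree_taylor R e]
  exact degree_sub_lt_left (degree_taylor R e) (by simpa using hR) (leadingCoeff_taylor e R)

lemma degree_lt_succ_of_degree_taylor_one_sub_lt {F : Type*} [CommRing F] [IsDomain F] [CharZero F]
    {R : F[X]} {d : ℕ} (h : (taylor 1 R - R).degree < d) : R.degree < (d + 1 : ℕ) := by
  by_contra! hd
  obtain ⟨k, hk⟩ : ∃ k, R.natDegree = k + 1 := Nat.exists_eq_add_one.2
    ((Nat.zero_lt_succ d).trans_le (le_natDegree_of_coe_le_degree hd))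
  have hdk : d ≤ k := Nat.succ_le_succ_iff.1 ((le_natDegree_of_coe_le_degree hd).trans hk.le)
  have hcoeff : (taylor 1 R - R).coeff k = (k + 1 : ℕ) * R.leadingCoeff := by
    have hlt : (hasseDeriv k R).natDegree < 2 := by
      have := natDegree_hasseDeriv_le R k
      omega
    rw [coeff_sub, taylor_coeff, eval_eq_sum_range' hlt, Finset.sum_range_succ,
      Finset.sum_range_one, hasseDeriv_coeff, hasseDeriv_coeff, leadingCoeff, hk]
    simp [add_comm 1 k]
  rw [coeff_eq_zero_of_degree_lt (h.trans_le (Nat.cast_le.2 hdk)), eq_comm, mul_eq_zero,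
    Nat.cast_eq_zero, leadingCoeff_eq_zero] at hcoeff
  obtain hk0 | rfl := hcoeff
  · omega
  · simp at hk

lemma leadingCoeff_nonneg_of_eventually_eval_eq {P : ℚ[X]} {H : ℕ → ℕ}
    (h : ∀ᶠ m : ℕ in atTop, P.eval (m : ℚ) = H m) : 0 ≤ P.leadingCoeff := by
  by_contra! hlt
  have hpos : ∀ᶠ m : ℕ in atTop, 0 ≤ P.eval (m : ℚ) := h.mono fun m hm => by rw [hm]; positivity
  rcases le_or_gt P.degree 0 with hd | hd
  · obtain ⟨m, hm⟩ := hpos.exists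
    rw [eq_C_of_degree_le_zero hd] at hm hlt
    simp only [eval_C, leadingCoeff_C] at hm hlt
    exact hm.not_gt hlt
  · have hbot := (P.tendsto_atBot_of_leadingCoeff_nonpos hd hlt.le).comp
      (tendsto_natCast_atTop_atTop (R := ℚ))
    obtain ⟨m, hm, hm'⟩ := (hpos.and (hbot.eventually (eventually_lt_atBot 0))).exists
    exact hm.not_gt hm'

lemma degree_add_eq_max_of_leadingCoeff_nonneg {F : Type*} [Semiring F] [PartialOrder F]
    [IsOrderedAddMonoid F] {P Q : F[X]} (hP : 0 ≤ P.leadingCoeff)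
    (hQ : 0 ≤ Q.leadingCoeff) : (P + Q).degree = max P.degree Q.degree := by
  obtain rfl | hP0 := eq_or_ne P 0
  · simp
  refine degree_add_eq_of_leadingCoeff_add_ne_zero ?_
  exact (add_pos_of_pos_of_nonneg (hP.lt_of_ne' (leadingCoeff_ne_zero.2 hP0)) hQ).ne'

lemma eq_of_eventually_eval_natCast_eq {F : Type*} [CommRing F] [IsDomain F] [CharZero F]
    {P Q : F[X]} (h : ∀ᶠ m : ℕ in atTop, P.eval (m : F) = Q.eval (m : F)) : P = Q := by
  refine Polynomial.eq_of_infinite_eval_eq P Q ?_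
  refine ((Nat.frequently_atTop_iff_infinite.1 h.frequently).image
    (Nat.cast_injective (R := F)).injOn).mono ?_
  rintro _ ⟨m, hm, rfl⟩
  exact hm

lemma exists_eventually_eval_eq_of_succ_eq_add {H H' : ℕ → ℚ} {Q : ℚ[X]}
    (hQ : ∀ᶠ m : ℕ in atTop, Q.eval (m : ℚ) = H' m) (hH : ∀ m, H (m + 1) = H' (m + 1) + H m) :
    ∃ R : ℚ[X], ∀ᶠ m : ℕ in atTop, R.eval (m : ℚ) = H m := by
  obtain ⟨R, hR⟩ := exists_taylor_one_sub_eq (taylor 1 Q)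
  obtain ⟨m₀, hm₀⟩ := eventually_atTop.1 hQ
  refine ⟨R + C (H m₀ - R.eval (m₀ : ℚ)), eventually_atTop.2 ⟨m₀, fun m hm => ?_⟩⟩
  induction m, hm using Nat.le_induction with
  | base => simp
  | succ m hm ih =>
    have hQm := hm₀ (m + 1) (by omega)
    have hRm := congrArg (eval (m : ℚ)) hR
    simp only [eval_sub, taylor_eval, eval_add, eval_C] at hRm ih ⊢
    rw [hH]
    push_cast at hQm ⊢
    linarith

end RationalPolynomials

section IdealHilbertFunction

variable {K A : Type*} [Field K] [CommRing A] [Algebra K A]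

/-- The Hilbert function `m ↦ dim (A / I)_m` of the quotient of a graded algebra by an ideal `I`,
where `(A / I)_m` is the image of the `m`-th graded piece. -/
noncomputable def idealHilbertFunction (𝒜 : ℕ → Submodule K A) (I : Ideal A) (m : ℕ) : ℕ :=
  Module.finrank K ((𝒜 m).map (Ideal.Quotient.mkₐ K I).toLinearMap)

/-- `P` is a Hilbert polynomial of the quotient by `I`: it agrees with the Hilbert function in all
large degrees. -/
def IsHilbertPolynomial (𝒜 : ℕ → Submodule K A) (I : Ideal A) (P : Polynomial ℚ) : Prop :=
  ∀ᶠ m : ℕ in atTop, P.eval (m : ℚ) = idealHilbertFunction 𝒜 I m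

variable {𝒜 : ℕ → Submodule K A} {I : Ideal A} {f : A} {e : ℕ} {P Q R : Polynomial ℚ}

lemma mkₐ_eq_zero_iff {x : A} : (Ideal.Quotient.mkₐ K I).toLinearMap x = 0 ↔ x ∈ I :=
  Ideal.Quotient.eq_zero_iff_mem

lemma IsHilbertPolynomial.unique (hP : IsHilbertPolynomial 𝒜 I P)
    (hQ : IsHilbertPolynomial 𝒜 I Q) : P = Q :=
  eq_of_eventually_eval_natCast_eq (hP.mp (hQ.mono fun _ h h' => h'.trans h.symm))

lemma idealHilbertFunction_eq_zero (h𝒜 : ∀ m, 𝒜 1 ^ m = 𝒜 m) (hI : (𝒜 1 : Set A) ⊆ I) {m : ℕ}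
    (hm : m ≠ 0) : idealHilbertFunction 𝒜 I m = 0 := by
  have hbot : (𝒜 1).map (Ideal.Quotient.mkₐ K I).toLinearMap = ⊥ :=
    LinearMap.le_ker_iff_map.1 fun _ hx => mkₐ_eq_zero_iff.2 (hI hx)
  rw [idealHilbertFunction, ← h𝒜, Submodule.map_pow, hbot, Submodule.bot_pow hm, finrank_bot]

lemma isHilbertPolynomial_zero (h𝒜 : ∀ m, 𝒜 1 ^ m = 𝒜 m) (hI : (𝒜 1 : Set A) ⊆ I) :
    IsHilbertPolynomial 𝒜 I 0 := by
  filter_upwards [eventually_ne_atTop 0] with m hm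
  rw [Polynomial.eval_zero, idealHilbertFunction_eq_zero h𝒜 hI hm, Nat.cast_zero]

variable [GradedAlgebra 𝒜]

lemma map_inf_ker_mkₐ_sup_span_singleton (hI : I.IsHomogeneous 𝒜) (hf : f ∈ 𝒜 e) (m : ℕ) :
    (𝒜 (m + e) ⊓ (Ideal.Quotient.mkₐ K (I ⊔ Ideal.span {f})).toLinearMap.ker).map
        (Ideal.Quotient.mkₐ K I).toLinearMap =
      (𝒜 m).map ((Ideal.Quotient.mkₐ K I).toLinearMap ∘ₗ LinearMap.mulRight K f) := by
  ext x
  simp only [Submodule.mem_map, Submodule.mem_inf, LinearMap.mem_ker, mkₐ_eq_zero_iff,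
    LinearMap.comp_apply, LinearMap.mulRight_apply]
  constructor
  · rintro ⟨g, ⟨hg, hgJ⟩, rfl⟩
    obtain ⟨b, hb, hgb⟩ := exists_sub_mul_mem_of_mem_sup_span_singleton hI hf hg hgJ
    rw [← mkₐ_eq_zero_iff (K := K), map_sub, sub_eq_zero] at hgb
    exact ⟨b, hb, hgb.symm⟩
  · rintro ⟨b, hb, rfl⟩
    exact ⟨b * f, ⟨SetLike.mul_mem_graded hb hf,
      Ideal.mem_sup_right (Ideal.mul_mem_left _ b (Ideal.mem_span_singleton_self f))⟩, rfl⟩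

variable [∀ m, FiniteDimensional K (𝒜 m)]

lemma idealHilbertFunction_pos [I.IsPrime] {x : A} (hx : x ∈ 𝒜 1) (hxI : x ∉ I) (m : ℕ) :
    0 < idealHilbertFunction 𝒜 I m := by
  have hxm : x ^ m ∈ 𝒜 m := by simpa using SetLike.pow_mem_graded m hx
  refine Module.finrank_pos_iff_exists_ne_zero.2 ⟨⟨_, x ^ m, hxm, rfl⟩, fun h => hxI ?_⟩
  exact Ideal.IsPrime.mem_of_pow_mem ‹_› m
    (Ideal.Quotient.eq_zero_iff_mem.1 (congrArg Subtype.val h))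

lemma idealHilbertFunction_add (hI : I.IsHomogeneous 𝒜) (hf : f ∈ 𝒜 e) (m : ℕ) :
    idealHilbertFunction 𝒜 I (m + e) = idealHilbertFunction 𝒜 (I ⊔ Ideal.span {f}) (m + e) +
      idealHilbertFunction 𝒜 (Submodule.colon I {f}) m := by
  have hker : (Ideal.Quotient.mkₐ K I).toLinearMap.ker ≤
      (Ideal.Quotient.mkₐ K (I ⊔ Ideal.span {f})).toLinearMap.ker := fun x hx =>
    mkₐ_eq_zero_iff.2 (Ideal.mem_sup_left (mkₐ_eq_zero_iff.1 hx))
  have hcolon : Module.finrank K ((𝒜 m).map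
      ((Ideal.Quotient.mkₐ K I).toLinearMap ∘ₗ LinearMap.mulRight K f)) =
      idealHilbertFunction 𝒜 (Submodule.colon I {f}) m := by
    refine finrank_map_eq_of_forall_eq_zero_iff _ _ _ fun g _ => ?_
    rw [LinearMap.comp_apply, LinearMap.mulRight_apply, mkₐ_eq_zero_iff, mkₐ_eq_zero_iff,
      Submodule.mem_colon_singleton, smul_eq_mul]
  rw [← hcolon, ← map_inf_ker_mkₐ_sup_span_singleton hI hf]
  exact (finrank_map_add_finrank_map_inf_ker (𝒜 (m + e)) hker).symm

lemma IsHilbertPolynomial.add_taylor (hI : I.IsHomogeneous 𝒜) (hf : f ∈ 𝒜 e)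
    (hP : IsHilbertPolynomial 𝒜 (I ⊔ Ideal.span {f}) P)
    (hQ : IsHilbertPolynomial 𝒜 (Submodule.colon I {f}) Q) :
    IsHilbertPolynomial 𝒜 I (P + Polynomial.taylor (-e : ℚ) Q) := by
  filter_upwards [hP, (tendsto_sub_atTop_nat e).eventually hQ, eventually_ge_atTop e]
    with m hPm hQm hm
  obtain ⟨k, rfl⟩ := Nat.exists_eq_add_of_le' hm
  rw [Nat.add_sub_cancel] at hQm
  rw [idealHilbertFunction_add hI hf, Polynomial.eval_add, Polynomial.taylor_eval, hPm,
    Nat.cast_add k e, add_neg_cancel_right, hQm, Nat.cast_add]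

lemma IsHilbertPolynomial.taylor_sub_eq_taylor [I.IsPrime] (hI : I.IsHomogeneous 𝒜) (hf : f ∈ 𝒜 e)
    (hfI : f ∉ I) (hP : IsHilbertPolynomial 𝒜 (I ⊔ Ideal.span {f}) P)
    (hR : IsHilbertPolynomial 𝒜 I R) :
    Polynomial.taylor (e : ℚ) R - R = Polynomial.taylor (e : ℚ) P := by
  have hPR := hP.add_taylor hI hf ((colon_singleton_eq_self hfI).symm ▸ hR)
  nth_rw 1 [hR.unique hPR]
  rw [map_add, Polynomial.taylor_taylor, add_neg_cancel, Polynomial.taylor_zero,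
    add_sub_cancel_right]

lemma IsHilbertPolynomial.ne_zero [I.IsPrime] {x : A} (hx : x ∈ 𝒜 1) (hxI : x ∉ I)
    (hR : IsHilbertPolynomial 𝒜 I R) : R ≠ 0 := by
  rintro rfl
  obtain ⟨m, hm⟩ := hR.exists
  rw [Polynomial.eval_zero, eq_comm, Nat.cast_eq_zero] at hm
  exact (idealHilbertFunction_pos hx hxI m).ne' hm

theorem exists_isHilbertPolynomial [IsNoetherianRing A] (h𝒜 : ∀ m, 𝒜 1 ^ m = 𝒜 m)
    (hI : I.IsHomogeneous 𝒜) : ∃ P, IsHilbertPolynomial 𝒜 I P := by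
  refine homogeneousIdeal_induction (𝒜 := 𝒜) (C := fun I => ∃ P, IsHilbertPolynomial 𝒜 I P)
    ⟨0, isHilbertPolynomial_zero h𝒜 fun _ _ => trivial⟩
    (fun I hprime hI ih => ?_) (fun I hI e f hf ⟨P, hP⟩ ⟨Q, hQ⟩ => ⟨_, hP.add_taylor hI hf hQ⟩) I hI
  by_cases h1 : (𝒜 1 : Set A) ⊆ I
  · exact ⟨0, isHilbertPolynomial_zero h𝒜 h1⟩
  obtain ⟨x, hx, hxI⟩ := Set.not_subset.1 h1
  obtain ⟨Q, hQ⟩ := ih _ (lt_sup_span_singleton hxI) (isHomogeneous_sup_span_singleton hI hx)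
  refine exists_eventually_eval_eq_of_succ_eq_add hQ fun m => ?_
  rw [idealHilbertFunction_add hI hx, colon_singleton_eq_self hxI, Nat.cast_add]

end IdealHilbertFunction

section KrullDimension

open TopologicalSpace Topology Order

variable {S T : Type*} [TopologicalSpace S] [TopologicalSpace T] {f : S → T} {Z A B : Set T} {d : ℕ}

lemma isIrreducible_preimage_of_isInducing (hf : IsInducing f) {Y : Set T} (hY : IsIrreducible Y)
    (hYf : Y ⊆ Set.range f) : IsIrreducible (f ⁻¹' Y) := by
  refine ⟨hY.nonempty.preimage' hYf, fun u v hu hv ⟨x, hxY, hxu⟩ ⟨y, hyY, hyv⟩ => ?_⟩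
  obtain ⟨U, hU, rfl⟩ := hf.isOpen_iff.1 hu
  obtain ⟨V, hV, rfl⟩ := hf.isOpen_iff.1 hv
  exact (hY.isPreirreducible U V hU hV ⟨f x, hxY, hxu⟩ ⟨f y, hyY, hyv⟩).preimage'
    (Set.inter_subset_left.trans hYf)

lemma exists_irreducibleCloseds_map_eq (hf : IsInducing f) (Y : IrreducibleCloseds T)
    (hY : (Y : Set T) ⊆ Set.range f) :
    ∃ Y' : IrreducibleCloseds S, IrreducibleCloseds.map f hf.continuous Y' = Y := by
  refine ⟨⟨f ⁻¹' Y, isIrreducible_preimage_of_isInducing hf Y.isIrreducible hY,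
    Y.isClosed.preimage hf.continuous⟩, IrreducibleCloseds.ext ?_⟩
  rw [IrreducibleCloseds.coe_map, IrreducibleCloseds.coe_mk, Set.image_preimage_eq_of_subset hY,
    Y.isClosed.closure_eq]

lemma irreducibleCloseds_map_le_map_iff (hf : IsInducing f) {Y Y' : IrreducibleCloseds S} :
    IrreducibleCloseds.map f hf.continuous Y ≤ IrreducibleCloseds.map f hf.continuous Y' ↔
      Y ≤ Y' := by
  refine ⟨fun h => ?_, fun h => IrreducibleCloseds.map_mono hf.continuous h⟩
  rw [← SetLike.coe_subset_coe, ← Y.isClosed.closure_eq, ← Y'.isClosed.closure_eq,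
    hf.closure_eq_preimage_closure_image, hf.closure_eq_preimage_closure_image]
  exact Set.preimage_mono h

lemma irreducibleCloseds_map_subset_range (hf : IsClosedEmbedding f) (Y : IrreducibleCloseds S) :
    (IrreducibleCloseds.map f hf.continuous Y : Set T) ⊆ Set.range f :=
  closure_minimal (Set.image_subset_range f Y) hf.isClosed_range

lemma height_irreducibleCloseds_map (hf : IsClosedEmbedding f) (Y : IrreducibleCloseds S) :
    height (IrreducibleCloseds.map f hf.continuous Y) = height Y := by
  refine (height_eq_of_strictMono _ (IrreducibleCloseds.map_strictMono_of_isInducing hf.isInducing)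
    (fun Y' W hW => ?_) Y).symm
  obtain ⟨W', rfl⟩ := exists_irreducibleCloseds_map_eq hf.isInducing W
    ((SetLike.coe_subset_coe.2 hW.le).trans (irreducibleCloseds_map_subset_range hf Y'))
  have hle := fun Y Y' => irreducibleCloseds_map_le_map_iff (Y := Y) (Y' := Y') hf.isInducing
  exact ⟨W', (lt_iff_lt_of_le_iff_le' (hle _ _) (hle _ _)).1 hW, rfl⟩

lemma krullDim_lt_natCast_iff {α : Type*} [Preorder α] :
    krullDim α < d ↔ ∀ a : α, height a < d := by
  rw [krullDim_lt_coe_iff]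
  refine ⟨fun h a => lt_of_not_ge fun hd => ?_, fun h l => ?_⟩
  · obtain ⟨l, -, hl⟩ := exists_series_of_le_height a hd
    exact (h l).ne hl
  · exact Nat.cast_lt.1 (length_le_height_last.trans_lt (h l.last))

lemma topologicalKrullDim_lt_iff (hZ : IsClosed Z) :
    topologicalKrullDim Z < d ↔
      ∀ Y : IrreducibleCloseds T, (Y : Set T) ⊆ Z → height Y < d := by
  have hemb := hZ.isClosedEmbedding_subtypeVal
  rw [topologicalKrullDim, krullDim_lt_natCast_iff]
  constructor
  · intro h Y hY
    obtain ⟨Y', rfl⟩ := exists_irreducibleCloseds_map_eq hemb.isInducing Y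
      (hY.trans Subtype.range_coe.ge)
    rw [height_irreducibleCloseds_map hemb]
    exact h Y'
  · intro h Y
    rw [← height_irreducibleCloseds_map hemb]
    exact h _ ((irreducibleCloseds_map_subset_range hemb Y).trans Subtype.range_coe.le)

lemma topologicalKrullDim_union_lt_iff (hA : IsClosed A) (hB : IsClosed B) :
    topologicalKrullDim ↥(A ∪ B) < d ↔ topologicalKrullDim A < d ∧ topologicalKrullDim B < d := by
  rw [topologicalKrullDim_lt_iff (hA.union hB), topologicalKrullDim_lt_iff hA,
    topologicalKrullDim_lt_iff hB]
  refine ⟨fun h => ⟨fun Y hY => h Y (hY.trans Set.subset_union_left),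
    fun Y hY => h Y (hY.trans Set.subset_union_right)⟩, fun ⟨hA', hB'⟩ Y hY => ?_⟩
  exact (isPreirreducible_iff_isClosed_union_isClosed.1 Y.isIrreducible.isPreirreducible A B hA hB
    hY).elim (hA' Y) (hB' Y)

lemma topologicalKrullDim_lt_of_ssubset (hZ : IsClosed Z) (hZirr : IsIrreducible Z)
    (hA : IsClosed A) (hAZ : A ⊂ Z) (hd : topologicalKrullDim Z < (d + 1 : ℕ)) :
    topologicalKrullDim A < d := by
  rw [topologicalKrullDim_lt_iff hA]
  intro Y hY
  have hYZ : Y < ⟨Z, hZirr, hZ⟩ := hY.trans_ssubset hAZ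
  have := (height_add_one_le hYZ).trans_lt ((topologicalKrullDim_lt_iff hZ).1 hd _ subset_rfl)
  rw [Nat.cast_add, Nat.cast_one] at this
  exact lt_of_add_lt_add_right this

lemma topologicalKrullDim_lt_succ_of_forall_ssubset (hZ : IsClosed Z) (hZirr : IsIrreducible Z)
    (h : ∀ W ⊂ Z, IsClosed W → topologicalKrullDim W < d) :
    topologicalKrullDim Z < (d + 1 : ℕ) := by
  rw [topologicalKrullDim_lt_iff hZ]
  intro Y hY
  have hYZ : Y ≤ ⟨Z, hZirr, hZ⟩ := hY
  refine (height_mono hYZ).trans_lt ?_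
  rw [Nat.cast_add, Nat.cast_one, ENat.lt_add_one_iff (ENat.natCast_ne_top d),
    height_le_coe_iff]
  exact fun W hW => (topologicalKrullDim_lt_iff W.isClosed).1 (h W hW W.isClosed) W subset_rfl

end KrullDimension

attribute [local instance] MvPolynomial.gradedAlgebra

section ZeroLoci

open MvPolynomial

variable {K : Type*} [Field K] {n : ℕ}

instance finite_homogeneousSubmodule {σ R : Type*} [Finite σ] [CommSemiring R] (m : ℕ) :
    Module.Finite R (homogeneousSubmodule σ R m) := by
  rw [Module.Finite.iff_fg, ← homogeneousSubmodule_one_pow]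
  refine Submodule.FG.pow ?_ m
  rw [homogeneousSubmodule_one_eq_span_X]
  exact Submodule.fg_span (Set.finite_range _)

lemma eval_smul_of_isHomogeneous {σ R : Type*} [CommSemiring R] {f : MvPolynomial σ R} {d : ℕ}
    (hf : f.IsHomogeneous d) (c : R) (v : σ → R) : eval (c • v) f = c ^ d * eval v f := by
  rw [eval_eq, eval_eq, Finset.mul_sum]
  refine Finset.sum_congr rfl fun s hs => ?_
  have hs' : s.degree = d := by
    rw [Finsupp.degree_eq_weight_one]
    exact hf (mem_support_iff.1 hs)
  simp only [Pi.smul_apply, smul_eq_mul, mul_pow, Finset.prod_mul_distrib]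
  rw [Finset.prod_pow_eq_pow_sum, ← hs', Finsupp.degree_apply]
  ring

variable {I : Ideal (MvPolynomial (Fin (n + 1)) K)} {f x : MvPolynomial (Fin (n + 1)) K} {d e : ℕ}

lemma eval_rep_mk_eq_zero_iff (hf : f.IsHomogeneous d) {v : Fin (n + 1) → K} (hv : v ≠ 0) :
    eval (Projectivization.mk K v hv).rep f = 0 ↔ eval v f = 0 := by
  obtain ⟨a, ha⟩ := Projectivization.exists_smul_eq_mk_rep K v hv
  rw [← ha, Units.smul_def, eval_smul_of_isHomogeneous hf, mul_eq_zero_iff_left]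
  exact pow_ne_zero d a.ne_zero

lemma isClosed_iff_exists_zeroLocus {Z : Set (PP K n)} :
    IsClosed Z ↔ ∃ S, HomogeneousSet S ∧ Z = zeroLocus S := by
  rw [← isOpen_compl_iff]
  change Zᶜᶜ ∈ {Z | ∃ S, HomogeneousSet S ∧ Z = zeroLocus S} ↔ _
  rw [compl_compl]
  rfl

lemma eval_eq_zero_of_forall_isHomogeneous
    (hI : I.IsHomogeneous (homogeneousSubmodule (Fin (n + 1)) K)) {v : Fin (n + 1) → K}
    (h : ∀ f ∈ I, ∀ d, f.IsHomogeneous d → eval v f = 0) : ∀ f ∈ I, eval v f = 0 := by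
  intro f hf
  rw [← sum_homogeneousComponent f, map_sum]
  exact Finset.sum_eq_zero fun i _ => h _ (homogeneousComponent_mem_of_mem hI hf i) i
    (homogeneousComponent_isHomogeneous _ _)

lemma isClosed_zeroLocus (hI : I.IsHomogeneous (homogeneousSubmodule (Fin (n + 1)) K)) :
    IsClosed (zeroLocus (I : Set (MvPolynomial (Fin (n + 1)) K))) := by
  refine isClosed_iff_exists_zeroLocus.2 ⟨{f | f ∈ I ∧ ∃ d, f.IsHomogeneous d},
    fun f hf => hf.2, Set.ext fun p => ⟨fun h f hf => h f hf.1, fun h => ?_⟩⟩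
  exact eval_eq_zero_of_forall_isHomogeneous hI fun f hf d hd => h f ⟨hf, d, hd⟩

lemma exists_isHomogeneous_eval_ne_zero {Z A : Set (PP K n)} (hA : IsClosed A) (h : ¬ Z ⊆ A) :
    ∃ (f : MvPolynomial (Fin (n + 1)) K) (d : ℕ), f.IsHomogeneous d ∧
      (∀ p ∈ A, eval p.rep f = 0) ∧ ∃ p ∈ Z, eval p.rep f ≠ 0 := by
  obtain ⟨S, hS, rfl⟩ := isClosed_iff_exists_zeroLocus.1 hA
  obtain ⟨p, hpZ, hpA⟩ := Set.not_subset.1 h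
  simp only [zeroLocus, Set.mem_ofPred_eq, not_forall] at hpA
  obtain ⟨f, hfS, hf⟩ := hpA
  obtain ⟨d, hd⟩ := hS f hfS
  exact ⟨f, d, hd, fun q hq => hq f hfS, p, hpZ, hf⟩

lemma zeroLocus_sup_span_singleton (I : Ideal (MvPolynomial (Fin (n + 1)) K))
    (f : MvPolynomial (Fin (n + 1)) K) :
    zeroLocus ((I ⊔ Ideal.span {f} : Ideal _) : Set (MvPolynomial (Fin (n + 1)) K)) =
      zeroLocus (I : Set (MvPolynomial (Fin (n + 1)) K)) ∩ {p | eval p.rep f = 0} := by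
  refine Set.Subset.antisymm (fun p hp => ⟨fun g hg => hp g (Ideal.mem_sup_left hg),
    hp f (Ideal.mem_sup_right (Ideal.mem_span_singleton_self f))⟩) ?_
  rintro p ⟨hp, hpf : eval p.rep f = 0⟩ g hg
  obtain ⟨a, ha, c, hc, rfl⟩ := Submodule.mem_sup.1 hg
  obtain ⟨b, rfl⟩ := Ideal.mem_span_singleton'.1 hc
  rw [map_add, hp a ha, map_mul, hpf, mul_zero, add_zero]

lemma zeroLocus_eq_union_colon (I : Ideal (MvPolynomial (Fin (n + 1)) K))
    (f : MvPolynomial (Fin (n + 1)) K) :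
    zeroLocus (I : Set (MvPolynomial (Fin (n + 1)) K)) =
      zeroLocus ((I ⊔ Ideal.span {f} : Ideal _) : Set (MvPolynomial (Fin (n + 1)) K)) ∪
        zeroLocus ((Submodule.colon I {f} : Ideal _) : Set (MvPolynomial (Fin (n + 1)) K)) := by
  rw [zeroLocus_sup_span_singleton]
  refine Set.Subset.antisymm (fun p hp => or_iff_not_imp_left.2 fun hpf g hg => ?_)
    (Set.union_subset Set.inter_subset_left fun p hp g hg => hp g (Ideal.le_colon hg))
  have hgf := hp _ (Submodule.mem_colon_singleton.1 hg)
  rw [smul_eq_mul, map_mul] at hgf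
  exact (mul_eq_zero.1 hgf).resolve_right fun hf => hpf ⟨hp, hf⟩

lemma zeroLocus_eq_empty
    (hI : (homogeneousSubmodule (Fin (n + 1)) K 1 : Set (MvPolynomial (Fin (n + 1)) K)) ⊆ I) :
    zeroLocus (I : Set (MvPolynomial (Fin (n + 1)) K)) = ∅ := by
  refine Set.eq_empty_of_forall_notMem fun p hp => p.rep_nonzero (funext fun i => ?_)
  simpa using hp _ (hI (isHomogeneous_X K i))

variable [IsAlgClosed K]

/- Multiplying by a linear form takes care of the origin of the affine cone, at which `f` need not
vanish. -/
lemma mul_mem_radical_of_forall_zeroLocus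
    (hI : I.IsHomogeneous (homogeneousSubmodule (Fin (n + 1)) K)) (hf : f.IsHomogeneous d)
    (hx : x.IsHomogeneous 1)
    (h : ∀ p ∈ zeroLocus (I : Set (MvPolynomial (Fin (n + 1)) K)), eval p.rep f = 0) :
    x * f ∈ I.radical := by
  rw [← vanishingIdeal_zeroLocus_eq_radical (K := K), mem_vanishingIdeal_iff]
  intro v hv
  simp only [mem_zeroLocus_iff, aeval_eq_eval] at hv ⊢
  rw [map_mul, mul_eq_zero]
  obtain rfl | hv0 := eq_or_ne v 0
  · left
    simpa using eval_smul_of_isHomogeneous hx 0 0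
  · exact Or.inr ((eval_rep_mk_eq_zero_iff hf hv0).1 (h _
      (eval_eq_zero_of_forall_isHomogeneous hI fun g hg d hd =>
        (eval_rep_mk_eq_zero_iff hd hv0).2 (hv g hg))))

variable [I.IsPrime]

lemma mem_of_forall_zeroLocus (hI : I.IsHomogeneous (homogeneousSubmodule (Fin (n + 1)) K))
    (hx : x.IsHomogeneous 1) (hxI : x ∉ I) (hf : f.IsHomogeneous d)
    (h : ∀ p ∈ zeroLocus (I : Set (MvPolynomial (Fin (n + 1)) K)), eval p.rep f = 0) : f ∈ I := by
  have hxf := mul_mem_radical_of_forall_zeroLocus hI hf hx h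
  rw [Ideal.IsPrime.radical ‹_›] at hxf
  exact (Ideal.IsPrime.mem_or_mem ‹_› hxf).resolve_left hxI

lemma isIrreducible_zeroLocus (hI : I.IsHomogeneous (homogeneousSubmodule (Fin (n + 1)) K))
    (hx : x.IsHomogeneous 1) (hxI : x ∉ I) :
    IsIrreducible (zeroLocus (I : Set (MvPolynomial (Fin (n + 1)) K))) := by
  constructor
  · by_contra hempty
    refine Ideal.IsPrime.one_notMem ‹I.IsPrime› (mem_of_forall_zeroLocus hI hx hxI
      (isHomogeneous_one _ _) fun p hp => absurd ⟨p, hp⟩ hempty)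
  · rw [isPreirreducible_iff_isClosed_union_isClosed]
    intro A B hA hB hAB
    by_contra! hcon
    obtain ⟨f, a, hf, hfA, p, hp, hfp⟩ := exists_isHomogeneous_eval_ne_zero hA hcon.1
    obtain ⟨g, b, hg, hgB, q, hq, hgq⟩ := exists_isHomogeneous_eval_ne_zero hB hcon.2
    have hfg : f * g ∈ I := by
      refine mem_of_forall_zeroLocus hI hx hxI (hf.mul hg) fun y hy => ?_
      rw [map_mul, mul_eq_zero]
      exact (hAB hy).imp (hfA y) (hgB y)
    rcases Ideal.IsPrime.mem_or_mem ‹_› hfg with h | h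
    · exact hfp (hp f h)
    · exact hgq (hq g h)

lemma zeroLocus_sup_span_singleton_ssubset
    (hI : I.IsHomogeneous (homogeneousSubmodule (Fin (n + 1)) K))
    (hx : x.IsHomogeneous 1) (hxI : x ∉ I) (hf : f.IsHomogeneous d) (hfI : f ∉ I) :
    zeroLocus ((I ⊔ Ideal.span {f} : Ideal _) : Set (MvPolynomial (Fin (n + 1)) K)) ⊂
      zeroLocus (I : Set (MvPolynomial (Fin (n + 1)) K)) := by
  rw [zeroLocus_sup_span_singleton, Set.ssubset_iff_subset_ne]
  refine ⟨Set.inter_subset_left, fun h => hfI (mem_of_forall_zeroLocus hI hx hxI hf ?_)⟩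
  exact Set.inter_eq_left.1 h

end ZeroLoci

section HilbertPolynomial

open MvPolynomial

variable {K : Type*} [Field K] {n : ℕ} {I : Ideal (MvPolynomial (Fin (n + 1)) K)}

/-- The Hilbert polynomials of the quotient by `I` have the dimension of the projective zero locus
of `I` as their degree. This is expressed by comparison with natural numbers, as the degree and the
dimension are extended by a bottom element in different ways and the dimension is not known to be
finite beforehand. -/
def HilbertDegreeEqDim (I : Ideal (MvPolynomial (Fin (n + 1)) K)) : Prop :=
  ∀ P, IsHilbertPolynomial (homogeneousSubmodule (Fin (n + 1)) K) I P → ∀ d : ℕ,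
    P.degree < d ↔ dim (zeroLocus (I : Set (MvPolynomial (Fin (n + 1)) K))) < d

lemma hilbertDegreeEqDim_of_irrelevant
    (hI : (homogeneousSubmodule (Fin (n + 1)) K 1 : Set (MvPolynomial (Fin (n + 1)) K)) ⊆ I) :
    HilbertDegreeEqDim I := by
  intro P hP d
  have hdim : dim (∅ : Set (PP K n)) = ⊥ :=
    Order.krullDim_eq_bot_iff.2 ⟨fun Y =>
      Y.isIrreducible.nonempty.ne_empty (Set.eq_empty_of_isEmpty _)⟩
  rw [hP.unique (isHilbertPolynomial_zero (homogeneousSubmodule_one_pow K) hI),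
    zeroLocus_eq_empty hI, hdim, Polynomial.degree_zero]
  exact iff_of_true (WithBot.bot_lt_coe _) (WithBot.bot_lt_coe _)

lemma HilbertDegreeEqDim.of_sup_of_colon
    (hI : I.IsHomogeneous (homogeneousSubmodule (Fin (n + 1)) K))
    {f : MvPolynomial (Fin (n + 1)) K} {e : ℕ} (hf : f.IsHomogeneous e)
    (hsup : HilbertDegreeEqDim (I ⊔ Ideal.span {f}))
    (hcolon : HilbertDegreeEqDim (Submodule.colon I {f})) : HilbertDegreeEqDim I := by
  intro R hR d
  have hJ := isHomogeneous_sup_span_singleton hI hf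
  have hJ' := isHomogeneous_colon_singleton hI hf
  obtain ⟨P, hP⟩ := exists_isHilbertPolynomial (homogeneousSubmodule_one_pow K) hJ
  obtain ⟨Q, hQ⟩ := exists_isHilbertPolynomial (homogeneousSubmodule_one_pow K) hJ'
  have hP0 := leadingCoeff_nonneg_of_eventually_eval_eq hP
  have hQ0 := leadingCoeff_nonneg_of_eventually_eval_eq hQ
  rw [← Polynomial.leadingCoeff_taylor (-e : ℚ) Q] at hQ0
  rw [hR.unique (hP.add_taylor hI hf hQ), degree_add_eq_max_of_leadingCoeff_nonneg hP0 hQ0,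
    Polynomial.degree_taylor, max_lt_iff, hsup P hP, hcolon Q hQ, zeroLocus_eq_union_colon I f]
  exact (topologicalKrullDim_union_lt_iff (isClosed_zeroLocus hJ) (isClosed_zeroLocus hJ')).symm

lemma degree_taylor_sub_lt_iff_dim_zeroLocus_sup_span_singleton_lt [I.IsPrime]
    (hI : I.IsHomogeneous (homogeneousSubmodule (Fin (n + 1)) K))
    {f : MvPolynomial (Fin (n + 1)) K} {e : ℕ} (hf : f.IsHomogeneous e) (hfI : f ∉ I)
    {P : Polynomial ℚ} (hP : IsHilbertPolynomial (homogeneousSubmodule (Fin (n + 1)) K) I P)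
    (hJ : HilbertDegreeEqDim (I ⊔ Ideal.span {f})) (d : ℕ) :
    (Polynomial.taylor (e : ℚ) P - P).degree < d ↔
      dim (zeroLocus ((I ⊔ Ideal.span {f} : Ideal _) :
        Set (MvPolynomial (Fin (n + 1)) K))) < d := by
  obtain ⟨Q, hQ⟩ := exists_isHilbertPolynomial (homogeneousSubmodule_one_pow K)
    (isHomogeneous_sup_span_singleton hI hf)
  rw [hQ.taylor_sub_eq_taylor hI hf hfI hP, Polynomial.degree_taylor, hJ Q hQ]

variable [IsAlgClosed K]

lemma HilbertDegreeEqDim.of_isPrime [I.IsPrime]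
    (hI : I.IsHomogeneous (homogeneousSubmodule (Fin (n + 1)) K))
    {x : MvPolynomial (Fin (n + 1)) K} (hx : x.IsHomogeneous 1) (hxI : x ∉ I)
    (ih : ∀ J > I, J.IsHomogeneous (homogeneousSubmodule (Fin (n + 1)) K) →
      HilbertDegreeEqDim J) : HilbertDegreeEqDim I := by
  intro P hP d
  have hZ := isClosed_zeroLocus hI
  have hirr := isIrreducible_zeroLocus hI hx hxI
  have cut {f : MvPolynomial (Fin (n + 1)) K} {e : ℕ} (hf : f.IsHomogeneous e) (hfI : f ∉ I) :=
    degree_taylor_sub_lt_iff_dim_zeroLocus_sup_span_singleton_lt hI hf hfI hP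
      (ih _ (lt_sup_span_singleton hfI) (isHomogeneous_sup_span_singleton hI hf))
  have hP0 : P ≠ 0 := hP.ne_zero (𝒜 := homogeneousSubmodule (Fin (n + 1)) K) hx hxI
  obtain _ | d := d
  · rw [Nat.cast_zero, Nat.cast_zero]
    exact iff_of_false (not_lt_of_ge (Polynomial.zero_le_degree_iff.2 hP0)) fun h =>
      not_lt_zero ((topologicalKrullDim_lt_iff hZ).1 h ⟨_, hirr, hZ⟩ subset_rfl)
  constructor
  · intro hd
    refine topologicalKrullDim_lt_succ_of_forall_ssubset hZ hirr fun W hW hWc => ?_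
    obtain ⟨f, e, hf, hfW, p, hp, hfp⟩ := exists_isHomogeneous_eval_ne_zero hWc hW.not_subset
    have hPd : P.degree ≤ d := Polynomial.degree_le_of_natDegree_le
      (Nat.lt_succ_iff.1 ((Polynomial.natDegree_lt_iff_degree_lt hP0).2 hd))
    have hlt := (cut hf (fun h => hfp (hp f h)) d).1 ((degree_taylor_sub_lt hP0 _).trans_le hPd)
    rw [zeroLocus_sup_span_singleton] at hlt
    have hWf : W ⊆ zeroLocus (I : Set (MvPolynomial (Fin (n + 1)) K)) ∩ {p | eval p.rep f = 0} :=
      fun q hq => ⟨hW.subset hq, hfW q hq⟩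
    exact (Topology.IsEmbedding.inclusion hWf).isInducing.topologicalKrullDim_le.trans_lt hlt
  · intro hd
    have := (cut hx hxI d).2 (topologicalKrullDim_lt_of_ssubset hZ hirr (isClosed_zeroLocus
      (isHomogeneous_sup_span_singleton hI hx))
      (zeroLocus_sup_span_singleton_ssubset hI hx hxI hx hxI) hd)
    rw [Nat.cast_one] at this
    exact degree_lt_succ_of_degree_taylor_one_sub_lt this

theorem hilbertDegreeEqDim (hI : I.IsHomogeneous (homogeneousSubmodule (Fin (n + 1)) K)) :
    HilbertDegreeEqDim I := by
  refine homogeneousIdeal_induction (C := HilbertDegreeEqDim)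
    (hilbertDegreeEqDim_of_irrelevant fun _ _ => trivial) (fun I hprime hI ih => ?_)
    (fun I hI e f hf => .of_sup_of_colon hI hf) I hI
  by_cases h1 : (homogeneousSubmodule (Fin (n + 1)) K 1 : Set (MvPolynomial (Fin (n + 1)) K)) ⊆ I
  · exact hilbertDegreeEqDim_of_irrelevant h1
  obtain ⟨x, hx, hxI⟩ := Set.not_subset.1 h1
  exact .of_isPrime hI hx hxI ih

end HilbertPolynomial

section HilbertFunction

open MvPolynomial

variable {K : Type*} [Field K] {n : ℕ} {X : Set (PP K n)}

lemma isHomogeneous_vanishingIdeal (X : Set (PP K n)) :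
    (vanishingIdeal X).IsHomogeneous (homogeneousSubmodule (Fin (n + 1)) K) :=
  Ideal.homogeneous_span _ _ fun _ hf => hf.1

lemma vanishingIdeal_le_ker_eval_rep {p : PP K n} (hp : p ∈ X) :
    vanishingIdeal X ≤ RingHom.ker (eval p.rep) :=
  Ideal.span_le.2 fun _ hg => hg.2 p hp

lemma mem_vanishingIdeal_iff {f : MvPolynomial (Fin (n + 1)) K} {d : ℕ} (hf : f.IsHomogeneous d) :
    f ∈ vanishingIdeal X ↔ ∀ p ∈ X, eval p.rep f = 0 :=
  ⟨fun h _ hp => vanishingIdeal_le_ker_eval_rep hp h, fun h => Ideal.subset_span ⟨⟨d, hf⟩, h⟩⟩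

lemma zeroLocus_vanishingIdeal (hX : IsClosed X) :
    zeroLocus (vanishingIdeal X : Set (MvPolynomial (Fin (n + 1)) K)) = X := by
  refine Set.Subset.antisymm ?_ fun p hp f hf => vanishingIdeal_le_ker_eval_rep hp hf
  obtain ⟨S, hS, rfl⟩ := isClosed_iff_exists_zeroLocus.1 hX
  exact fun p hp f hf => hp f (Ideal.subset_span ⟨hS f hf, fun q hq => hq f hf⟩)

lemma hilbertPolynomial_eq {P : Polynomial ℚ}
    (hP : ∀ᶠ m : ℕ in atTop, P.eval (m : ℚ) = hilbertFunction X m) : hilbertPolynomial X = P := by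
  have h : ∃ P : Polynomial ℚ, ∃ m₀ : ℕ, ∀ m ≥ m₀, P.eval (m : ℚ) = (hilbertFunction X m : ℚ) :=
    ⟨P, eventually_atTop.1 hP⟩
  rw [hilbertPolynomial, dif_pos h]
  refine eq_of_eventually_eval_natCast_eq ?_
  filter_upwards [eventually_atTop.2 h.choose_spec, hP] with m h1 h2
  rw [h1, h2]

theorem eventually_eval_hilbertPolynomial (X : Set (PP K n)) :
    ∀ᶠ m : ℕ in atTop, (hilbertPolynomial X).eval (m : ℚ) = hilbertFunction X m := by
  obtain ⟨P, hP⟩ := exists_isHilbertPolynomial (homogeneousSubmodule_one_pow K)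
    (isHomogeneous_vanishingIdeal X)
  rw [hilbertPolynomial_eq hP]
  exact hP

theorem dim_eq_natCast_iff [IsAlgClosed K] (hX : IsClosed X) {r : ℕ} :
    dim X = r ↔ (hilbertPolynomial X).degree = r := by
  have hlt (d : ℕ) : dim X < d ↔ (hilbertPolynomial X).degree < d := by
    rw [hilbertDegreeEqDim (isHomogeneous_vanishingIdeal X) _ (eventually_eval_hilbertPolynomial X),
      zeroLocus_vanishingIdeal hX]
  have hdim : dim X < (r + 1 : ℕ) ↔ dim X ≤ r := by
    rw [Nat.cast_add, Nat.cast_one]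
    exact ENat.WithBot.lt_add_one_iff
  have hdeg : (hilbertPolynomial X).degree < (r + 1 : ℕ) ↔ (hilbertPolynomial X).degree ≤ r := by
    rw [← Polynomial.mem_degreeLT, Polynomial.degreeLT_succ_eq_degreeLE, Polynomial.mem_degreeLE]
  rw [le_antisymm_iff, le_antisymm_iff, ← hdim, ← hdeg, ← not_lt, ← not_lt, hlt, hlt]

end HilbertFunction

section FunctionSpaces

variable {K : Type*} [Field K]

lemma exists_bijective_funLeft_comp_subtype {Y : Type*} (V : Submodule K (Y → K))
    [FiniteDimensional K V] :
    ∃ e : Fin (Module.finrank K V) → Y,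
      Function.Bijective (LinearMap.funLeft K K e ∘ₗ V.subtype) := by
  let φ (y : Y) : Module.Dual K V := LinearMap.proj y ∘ₗ V.subtype
  obtain ⟨κ, a, -, hspan, hli⟩ := exists_linearIndependent' K φ
  have hinj : Function.Injective (LinearMap.funLeft K K a ∘ₗ V.subtype) := by
    refine (injective_iff_map_eq_zero _).2 fun v hv => Subtype.ext (funext fun y => ?_)
    have hle : Submodule.span K (Set.range φ) ≤ (Module.Dual.eval K V v).ker := by
      rw [← hspan, Submodule.span_le]
      rintro _ ⟨k, rfl⟩
      exact congrFun hv k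
    exact hle (Submodule.subset_span ⟨y, rfl⟩)
  have := hli.finite
  have := Fintype.ofFinite κ
  have hcard : Fintype.card κ = Module.finrank K V := by
    refine le_antisymm ?_ ?_
    · rw [← Subspace.dual_finrank_eq]
      exact hli.fintype_card_le_finrank
    · rw [← Module.finrank_fintype_fun_eq_card (R := K)]
      exact LinearMap.finrank_le_finrank_of_injective hinj
  let σ := Fintype.equivFinOfCardEq hcard
  refine ⟨a ∘ σ.symm, ?_⟩
  have hσ : Function.Injective (LinearMap.funLeft K K (a ∘ σ.symm) ∘ₗ V.subtype) :=
    (LinearMap.funLeft_injective_of_surjective K K _ σ.symm.surjective).comp hinj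
  exact ⟨hσ, (LinearMap.injective_iff_surjective_of_finrank_eq_finrank (by simp)).1 hσ⟩

lemma linearIndependent_iff_exists_det_ne_zero {ι J : Type*} [Fintype ι] [DecidableEq ι]
    (M : ι → J → K) :
    LinearIndependent K M ↔ ∃ e : ι → J, (Matrix.of fun a b => M a (e b)).det ≠ 0 := by
  simp only [← isUnit_iff_ne_zero, ← Matrix.isUnit_iff_isUnit_det,
    ← Matrix.linearIndependent_rows_iff_isUnit]
  refine ⟨fun hM => ?_, fun ⟨e, he⟩ => LinearIndependent.of_comp (LinearMap.funLeft K K e) he⟩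
  have hfin : FiniteDimensional K (Submodule.span K (Set.range M)) :=
    FiniteDimensional.span_of_finite K (Set.finite_range M)
  obtain ⟨e, he⟩ := exists_bijective_funLeft_comp_subtype (Submodule.span K (Set.range M))
  let σ := Fintype.equivFinOfCardEq (finrank_span_eq_card hM).symm
  refine ⟨e ∘ σ, hM.map_injOn (LinearMap.funLeft K K (e ∘ σ)) fun v hv w hw h => ?_⟩
  have hvw : LinearMap.funLeft K K e v = LinearMap.funLeft K K e w :=
    LinearMap.funLeft_injective_of_surjective K K _ σ.surjective h
  exact congrArg Subtype.val (@he.1 ⟨v, hv⟩ ⟨w, hw⟩ hvw)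

lemma linearIndependent_of_forall_apply_eq_ite {ι J : Type*} [DecidableEq ι]
    {v : ι → J → K} (e : ι → J) (h : ∀ a b, v a (e b) = if a = b then 1 else 0) :
    LinearIndependent K v := by
  refine LinearIndependent.of_comp (LinearMap.funLeft K K e) ?_
  convert Pi.linearIndependent_single_one ι K with a
  ext b
  simp [LinearMap.funLeft_apply, h, Pi.single_apply, eq_comm]

lemma exists_basis_forall_apply_eq_ite {Y : Type*} (V : Submodule K (Y → K))
    [FiniteDimensional K V] :
    ∃ (e : Fin (Module.finrank K V) → Y) (b : Module.Basis (Fin (Module.finrank K V)) K V),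
      ∀ i j, (b i : Y → K) (e j) = if i = j then 1 else 0 := by
  obtain ⟨e, he⟩ := exists_bijective_funLeft_comp_subtype V
  let E := LinearEquiv.ofBijective _ he
  refine ⟨e, .ofEquivFun E, fun i j => ?_⟩
  have hE : E (E.symm (Pi.single i 1)) j = (Pi.single i 1 : _ → K) j := by
    rw [E.apply_symm_apply]
  rw [Module.Basis.coe_ofEquivFun]
  exact hE.trans (by simp [Pi.single_apply, eq_comm])

end FunctionSpaces

section SegreProducts

variable {K ι : Type*} [Field K] [Fintype ι] {H : ι → Type*}

/-- The family of all products with one factor from each of the families `u i`. For scalars it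
consists of the coordinates of the image of the point `u` under the Segre map, for vectors in
`J → K` of the coordinatewise products of the members of the families. -/
def segreProduct {B : Type*} [CommMonoid B] (u : ∀ i, H i → B) (α : ∀ i, H i) : B :=
  ∏ i, u i (α i)

lemma segreProduct_apply_eq_ite {J : Type*} [∀ i, DecidableEq (H i)] [DecidableEq (∀ i, H i)]
    {u : ∀ i, H i → J → K} {β α : ∀ i, H i} {j : J}
    (h : ∀ i a, u i a j = if a = β i then 1 else 0) :
    segreProduct u α j = if α = β then 1 else 0 := by
  simp [segreProduct, h, Finset.prod_ite_zero, funext_iff]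

lemma prod_span_range {B : Type*} [CommSemiring B] [Algebra K B] (u : ∀ i, H i → B) :
    ∏ i, Submodule.span K (Set.range (u i)) = Submodule.span K (Set.range (segreProduct u)) := by
  rw [Submodule.prod_span]
  congr 1
  ext b
  simp only [Set.mem_fintype_prod, Set.mem_range, segreProduct]
  constructor
  · rintro ⟨g, hg, rfl⟩
    choose α hα using hg
    exact ⟨α, Finset.prod_congr rfl fun i _ => hα i⟩
  · rintro ⟨α, rfl⟩
    exact ⟨fun i => u i (α i), fun i => ⟨α i, rfl⟩, rfl⟩

variable {B : Type*} [CommRing B] [Algebra K B]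

lemma prod_linearCombination [DecidableEq ι] [∀ i, Fintype (H i)] (A : ∀ i, H i → B)
    (c : ∀ i, H i → K) :
    ∏ i, Fintype.linearCombination K (A i) (c i) =
      Fintype.linearCombination K (segreProduct A) (segreProduct c) := by
  simp only [Fintype.linearCombination_apply]
  rw [Fintype.prod_sum]
  exact Finset.sum_congr rfl fun α _ => Finset.prod_smul _ _ _

lemma prod_ne_zero_of_linearIndependent_segreProduct [∀ i, Finite (H i)] {A : ∀ i, H i → B}
    (hA : LinearIndependent K (segreProduct A)) {v : ι → B}
    (hv : ∀ i, v i ∈ Submodule.span K (Set.range (A i))) (hv0 : ∀ i, v i ≠ 0) :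
    ∏ i, v i ≠ 0 := by
  classical
  have hfin (i) : Fintype (H i) := Fintype.ofFinite (H i)
  choose c hc using fun i => (Submodule.mem_span_range_iff_exists_fun K).1 (hv i)
  simp only [← Fintype.linearCombination_apply] at hc
  have hc0 (i) : ∃ a, c i a ≠ 0 := by
    by_contra! h
    exact hv0 i (by rw [← hc i, funext h]; exact map_zero _)
  choose α hα using hc0
  intro h
  simp only [← hc, prod_linearCombination] at h
  have hc0 := (injective_iff_map_eq_zero _).1 hA.fintypeLinearCombination_injective _ h
  exact Finset.prod_ne_zero_iff.2 (fun i _ => hα i) (congrFun hc0 α)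

end SegreProducts

section CoordinateFunctions

variable {K Y J J' : Type*} [Field K]

/-- The space of functions spanned by the coordinate functions on a family of vectors. For
representatives of the points of a subset of projective space it is the linear part of the
homogeneous coordinate ring, realized as a space of functions. -/
def coordinateSpan (w : Y → J → K) : Submodule K (Y → K) :=
  Submodule.span K (Set.range fun j y => w y j)

instance [Finite J] (w : Y → J → K) (m : ℕ) :
    FiniteDimensional K (coordinateSpan w ^ m : Submodule K (Y → K)) :=
  Module.Finite.iff_fg.2 (Submodule.FG.pow (Submodule.fg_span (Set.finite_range _)) m)

lemma coordinateSpan_eq_range [Finite J] (w : Y → J → K) :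
    coordinateSpan w = (LinearMap.pi fun y => Module.Dual.eval K (J → K) (w y)).range := by
  classical
  rw [LinearMap.range_eq_map, ← (Pi.basisFun K J).dualBasis.span_eq, Submodule.map_span,
    ← Set.range_comp, coordinateSpan]
  congr 2
  ext j y
  simp

lemma coordinateSpan_comp_of_injective [Finite J] [Finite J'] (w : Y → J → K)
    {T : (J → K) →ₗ[K] (J' → K)} (hT : Function.Injective T) :
    coordinateSpan (T ∘ w) = coordinateSpan w := by
  rw [coordinateSpan_eq_range, coordinateSpan_eq_range]
  exact LinearMap.range_comp_of_range_eq_top (f := T.dualMap)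
    (LinearMap.pi fun y => Module.Dual.eval K (J → K) (w y))
    (LinearMap.range_eq_top.2 (LinearMap.dualMap_surjective_of_injective hT))

end CoordinateFunctions

section ExternalProducts

variable {K ι J : Type*} [Field K] {Y H : ι → Type*}

/-- Precomposition of functions on a factor with the projection of a product to that factor. -/
def pullback (i : ι) : (Y i → K) →ₐ[K] ((∀ i, Y i) → K) :=
  AlgHom.pi fun P => Pi.evalAlgHom K _ (P i)

variable [Fintype ι]

lemma finrank_prod_map_pullback (V : ∀ i, Submodule K (Y i → K)) [∀ i, FiniteDimensional K (V i)] :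
    Module.finrank K (∏ i, (V i).map (pullback i : (Y i → K) →ₐ[K] _).toLinearMap :
      Submodule K ((∀ i, Y i) → K)) = ∏ i, Module.finrank K (V i) := by
  classical
  choose e b hb using fun i => exists_basis_forall_apply_eq_ite (V i)
  have hspan (i) : (V i).map (pullback i : (Y i → K) →ₐ[K] _).toLinearMap =
      Submodule.span K (Set.range fun a => pullback i (b i a : Y i → K)) := by
    conv_lhs => rw [← Submodule.map_subtype_top (V i), ← (b i).span_eq]
    rw [Submodule.map_span, Submodule.map_span, ← Set.range_comp, ← Set.range_comp]
    rfl
  have hli : LinearIndependent K (segreProduct fun i a => pullback i (b i a : Y i → K)) :=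
    linearIndependent_of_forall_apply_eq_ite (fun β i => e i (β i)) fun α β =>
      segreProduct_apply_eq_ite fun i a => hb i a (β i)
  rw [Finset.prod_congr rfl fun i _ => hspan i, prod_span_range, finrank_span_eq_card hli,
    Fintype.card_pi]
  simp only [Fintype.card_fin]

lemma prod_map_pullback_coordinateSpan (u : ∀ i, Y i → H i → K) :
    ∏ i, (coordinateSpan (u i)).map (pullback i : (Y i → K) →ₐ[K] _).toLinearMap =
      coordinateSpan fun P : ∀ i, Y i => segreProduct fun i => u i (P i) := by
  simp only [coordinateSpan, Submodule.map_span, ← Set.range_comp]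
  rw [prod_span_range]
  congr 2
  ext α P
  exact Finset.prod_apply _ _ _

variable [Finite J] [∀ i, Finite (H i)]

lemma coordinateSpan_prod {A : ∀ i, H i → J → K} (hA : ∀ i, LinearIndependent K (A i))
    (hAprod : LinearIndependent K (segreProduct A)) {w : ∀ i, Y i → J → K}
    (hw : ∀ i y, w i y ∈ Submodule.span K (Set.range (A i))) :
    coordinateSpan (fun P : ∀ i, Y i => ∏ i, w i (P i)) =
      ∏ i, (coordinateSpan (w i)).map (pullback i : (Y i → K) →ₐ[K] _).toLinearMap := by
  classical
  have hfin (i) : Fintype (H i) := Fintype.ofFinite (H i)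
  choose u hu using fun i y => (Submodule.mem_span_range_iff_exists_fun K).1 (hw i y)
  obtain rfl : (fun i => Fintype.linearCombination K (A i) ∘ u i) = w :=
    funext fun i => funext (hu i)
  simp only [coordinateSpan_comp_of_injective _ (hA _).fintypeLinearCombination_injective,
    prod_map_pullback_coordinateSpan, Function.comp_apply, prod_linearCombination]
  exact coordinateSpan_comp_of_injective _ hAprod.fintypeLinearCombination_injective

lemma finrank_coordinateSpan_prod_pow {A : ∀ i, H i → J → K} (hA : ∀ i, LinearIndependent K (A i))
    (hAprod : LinearIndependent K (segreProduct A)) {w : ∀ i, Y i → J → K}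
    (hw : ∀ i y, w i y ∈ Submodule.span K (Set.range (A i))) (m : ℕ) :
    Module.finrank K (coordinateSpan (fun P : ∀ i, Y i => ∏ i, w i (P i)) ^ m :
        Submodule K ((∀ i, Y i) → K)) =
      ∏ i, Module.finrank K (coordinateSpan (w i) ^ m : Submodule K (Y i → K)) := by
  rw [coordinateSpan_prod hA hAprod hw, ← Finset.prod_pow,
    Finset.prod_congr rfl fun i _ => (Submodule.map_pow (coordinateSpan (w i)) _ m).symm,
    finrank_prod_map_pullback]

end ExternalProducts

section CoordinateRings

open MvPolynomial

variable {K Y J : Type*} [Field K] {n : ℕ} {X : Set (PP K n)}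

lemma aeval_coordinates_apply (w : Y → J → K) (f : MvPolynomial J K) (y : Y) :
    aeval (fun j y => w y j) f y = eval (w y) f := by
  have h : (Pi.evalAlgHom K (fun _ : Y => K) y).comp (aeval fun j y => w y j) = aeval (w y) :=
    algHom_ext fun j => by simp
  rw [← aeval_eq_eval]
  exact DFunLike.congr_fun h f

lemma map_aeval_homogeneousSubmodule (w : Y → J → K) (m : ℕ) :
    (homogeneousSubmodule J K m).map
      (aeval (fun j y => w y j) : MvPolynomial J K →ₐ[K] (Y → K)).toLinearMap =
      coordinateSpan w ^ m := by
  rw [← homogeneousSubmodule_one_pow, Submodule.map_pow, homogeneousSubmodule_one_eq_span_X,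
    Submodule.map_span, ← Set.range_comp, coordinateSpan]
  congr 3
  ext j
  simp

lemma hilbertFunction_eq_finrank_coordinateSpan_pow (w : Y → Fin (n + 1) → K) (m : ℕ)
    (h : ∀ f : MvPolynomial (Fin (n + 1)) K, f.IsHomogeneous m →
      ((∀ p ∈ X, eval p.rep f = 0) ↔ ∀ y, eval (w y) f = 0)) :
    hilbertFunction X m = Module.finrank K (coordinateSpan w ^ m : Submodule K (Y → K)) := by
  rw [← map_aeval_homogeneousSubmodule]
  refine finrank_map_eq_of_forall_eq_zero_iff _ _ _ fun f hf => ?_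
  rw [mkₐ_eq_zero_iff, mem_vanishingIdeal_iff hf, h f hf, AlgHom.toLinearMap_apply, funext_iff]
  simp only [aeval_coordinates_apply, Pi.zero_apply]

lemma forall_closure_eval_rep_eq_zero_iff {f : MvPolynomial (Fin (n + 1)) K} {d : ℕ}
    (hf : f.IsHomogeneous d) :
    (∀ p ∈ closure X, eval p.rep f = 0) ↔ ∀ p ∈ X, eval p.rep f = 0 := by
  have hcl : IsClosed (zeroLocus {f} : Set (PP K n)) :=
    isClosed_iff_exists_zeroLocus.2 ⟨{f}, by rintro _ rfl; exact ⟨d, hf⟩, rfl⟩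
  simpa [zeroLocus, Set.subset_def] using hcl.closure_subset_iff (s := X)

end CoordinateRings

section GenericSubspaces

variable {K : Type*} [Field K] {n ℓ : ℕ} {h : Fin ℓ → ℕ}

/-- The tuples of linear subspaces whose Hadamard product spans a linear subspace of the largest
possible dimension: the vector space spanned by all coordinatewise products has dimension
`∏ i, (h i + 1)`. -/
def independentSubspaces (K : Type*) [Field K] (n : ℕ) {ℓ : ℕ} (h : Fin ℓ → ℕ) :
    Set (LinearSubspaces K n h) :=
  {L | Module.finrank K (∏ i, (L i).1 : Submodule K (Fin (n + 1) → K)) = ∏ i, (h i + 1)}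

variable {L : LinearSubspaces K n h} {A : ∀ i, Fin (h i + 1) → Fin (n + 1) → K}

lemma mem_independentSubspaces_iff (hA : IsParameterization A L) :
    L ∈ independentSubspaces K n h ↔ LinearIndependent K (segreProduct A) := by
  have hspan : ∏ i, (L i).1 = Submodule.span K (Set.range (segreProduct A)) := by
    rw [← prod_span_range]
    exact Finset.prod_congr rfl fun i _ => (hA i).2.symm
  rw [linearIndependent_iff_card_eq_finrank_span, Set.finrank, ← hspan, Fintype.card_pi]
  simp only [Fintype.card_fin]
  exact eq_comm

lemma exists_isParameterization (L : LinearSubspaces K n h) :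
    ∃ A : ∀ i, Fin (h i + 1) → Fin (n + 1) → K, IsParameterization A L := by
  let b (i) : Module.Basis (Fin (h i + 1)) K (L i).1 := Module.finBasisOfFinrankEq K _ (L i).2
  refine ⟨fun i => (L i).1.subtype ∘ b i, fun i => ⟨?_, ?_⟩⟩
  · exact (b i).linearIndependent.map' _ (Submodule.ker_subtype _)
  · rw [Set.range_comp, ← Submodule.map_span, (b i).span_eq, Submodule.map_subtype_top]

lemma isZariskiOpen_independentSubspaces : IsZariskiOpen (independentSubspaces K n h) := by
  let M (e : (∀ i, Fin (h i + 1)) → Fin (n + 1)) :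
      Matrix (∀ i, Fin (h i + 1)) (∀ i, Fin (h i + 1))
        (MvPolynomial (Σ i : Fin ℓ, Fin (h i + 1) × Fin (n + 1)) K) :=
    Matrix.of fun α β => ∏ i, MvPolynomial.X ⟨i, α i, e β⟩
  refine ⟨Set.range fun e => (M e).det, fun L A hA => ?_⟩
  rw [mem_independentSubspaces_iff hA, linearIndependent_iff_exists_det_ne_zero,
    Set.exists_range_iff]
  refine exists_congr fun e => ?_
  rw [RingHom.map_det]
  refine not_congr (Eq.congr_left (congrArg Matrix.det ?_))
  ext α β
  simp [M, segreProduct]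

/- Distinct multi-indices `β` are given distinct coordinates `s β`, and the vector `A i a` is the
indicator of the coordinates `s β` with `β i = a`; the product of the `A i (α i)` is then the
indicator of `s α`. -/
lemma nonempty_independentSubspaces (hn : ∏ i, (h i + 1) ≤ n + 1) :
    (independentSubspaces K n h).Nonempty := by
  obtain ⟨s⟩ : Nonempty ((∀ i, Fin (h i + 1)) ↪ Fin (n + 1)) :=
    Function.Embedding.nonempty_of_card_le (by simpa using hn)
  let A (i) (a : Fin (h i + 1)) (j : Fin (n + 1)) : K := if ∃ β, s β = j ∧ β i = a then 1 else 0
  have hA (i a β) : A i a (s β) = if a = β i then 1 else 0 := by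
    simp [A, eq_comm]
  have hAi (i) : LinearIndependent K (A i) :=
    linearIndependent_of_forall_apply_eq_ite (fun a => s (Function.update 0 i a)) fun a b => by
      rw [hA, Function.update_self]
  let L : LinearSubspaces K n h := fun i => ⟨Submodule.span K (Set.range (A i)), by
    rw [finrank_span_eq_card (hAi i), Fintype.card_fin]⟩
  refine ⟨L, (mem_independentSubspaces_iff fun i => ⟨hAi i, rfl⟩).2 ?_⟩
  exact linearIndependent_of_forall_apply_eq_ite s fun α β =>
    segreProduct_apply_eq_ite fun i a => hA i a β

end GenericSubspaces

section HadamardProducts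

variable {K : Type*} [Field K] {n ℓ : ℕ} {h : Fin ℓ → ℕ} {X : Fin ℓ → Set (PP K n)}

lemma rep_mem_of_mem_toSet {L : LinearSubspaces K n h} {i : Fin ℓ} {p : PP K n}
    (hp : p ∈ L.toSet i) : p.rep ∈ (L i).1 := by
  refine hp ?_
  rw [Projectivization.submodule_eq]
  exact Submodule.mem_span_singleton_self _

lemma forall_hadamardProduct_eval_rep_eq_zero_iff
    (hX : ∀ P : ∀ i, X i, ∏ i, (P i).1.rep ≠ 0) {f : MvPolynomial (Fin (n + 1)) K} {d : ℕ}
    (hf : f.IsHomogeneous d) :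
    (∀ Q ∈ hadamardProduct X, MvPolynomial.eval Q.rep f = 0) ↔
      ∀ P : ∀ i, X i, MvPolynomial.eval (∏ i, (P i).1.rep) f = 0 := by
  simp only [hadamardProduct, ← Finset.prod_fn]
  rw [forall_closure_eval_rep_eq_zero_iff hf]
  constructor
  · intro h P
    rw [← eval_rep_mk_eq_zero_iff hf (hX P)]
    exact h _ ⟨fun i => P i, fun i => (P i).2, hX P, rfl⟩
  · rintro h _ ⟨P, hP, hP0, rfl⟩
    rw [eval_rep_mk_eq_zero_iff hf]
    exact h fun i => ⟨P i, hP i⟩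

theorem hilbertFunction_hadamardProduct {L : LinearSubspaces K n h}
    (hL : L ∈ independentSubspaces K n h) (hX : ∀ i, X i ⊆ L.toSet i) (m : ℕ) :
    hilbertFunction (hadamardProduct X) m = ∏ i, hilbertFunction (X i) m := by
  obtain ⟨A, hA⟩ := exists_isParameterization L
  have hAprod := (mem_independentSubspaces_iff hA).1 hL
  have hw (i) (p : X i) : p.1.rep ∈ Submodule.span K (Set.range (A i)) :=
    (hA i).2 ▸ rep_mem_of_mem_toSet (hX i p.2)
  have hne (P : ∀ i, X i) : ∏ i, (P i).1.rep ≠ 0 :=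
    prod_ne_zero_of_linearIndependent_segreProduct hAprod (fun i => hw i (P i))
      fun i => (P i).1.rep_nonzero
  have hXi (i) : hilbertFunction (X i) m =
      Module.finrank K (coordinateSpan (fun p : X i => p.1.rep) ^ m : Submodule K (X i → K)) :=
    hilbertFunction_eq_finrank_coordinateSpan_pow _ m fun f _ =>
      ⟨fun h p => h p p.2, fun h p hp => h ⟨p, hp⟩⟩
  rw [hilbertFunction_eq_finrank_coordinateSpan_pow _ m fun f hf =>
      forall_hadamardProduct_eval_rep_eq_zero_iff hne hf,
    finrank_coordinateSpan_prod_pow (fun i => (hA i).1) hAprod hw]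
  exact Finset.prod_congr rfl fun i _ => (hXi i).symm

lemma hilbertPolynomial_hadamardProduct
    (hH : ∀ m, hilbertFunction (hadamardProduct X) m = ∏ i, hilbertFunction (X i) m) :
    hilbertPolynomial (hadamardProduct X) = ∏ i, hilbertPolynomial (X i) := by
  refine hilbertPolynomial_eq ?_
  filter_upwards [eventually_all.2 fun i => eventually_eval_hilbertPolynomial (X i)] with m hm
  rw [Polynomial.eval_prod, hH, Nat.cast_prod]
  exact Finset.prod_congr rfl fun i _ => hm i

variable {r : Fin ℓ → ℕ}

theorem dim_hadamardProduct [IsAlgClosed K]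
    (hH : ∀ m, hilbertFunction (hadamardProduct X) m = ∏ i, hilbertFunction (X i) m)
    (hX : ∀ i, IsClosed (X i)) (hr : ∀ i, dim (X i) = (r i : WithBot ℕ∞)) :
    dim (hadamardProduct X) = ((∑ i, r i : ℕ) : WithBot ℕ∞) := by
  rw [dim_eq_natCast_iff (X := hadamardProduct X) isClosed_closure,
    hilbertPolynomial_hadamardProduct hH, Polynomial.degree_prod, Nat.cast_sum]
  exact Finset.sum_congr rfl fun i _ => (dim_eq_natCast_iff (hX i)).1 (hr i)

theorem degree_hadamardProduct
    (hH : ∀ m, hilbertFunction (hadamardProduct X) m = ∏ i, hilbertFunction (X i) m)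
    (hr : ∀ i, (hilbertPolynomial (X i)).degree = r i) :
    degree (hadamardProduct X) = (Nat.multinomial Finset.univ r : ℚ) * ∏ i, degree (X i) := by
  have hnat (i) : (hilbertPolynomial (X i)).natDegree = r i :=
    Polynomial.natDegree_eq_of_degree_eq_some (hr i)
  have hne (i) : hilbertPolynomial (X i) ≠ 0 := by
    intro h0
    simpa [h0] using hr i
  simp only [degree, hilbertPolynomial_hadamardProduct hH, Polynomial.leadingCoeff_prod,
    Polynomial.natDegree_prod _ _ fun i _ => hne i, hnat, Finset.prod_mul_distrib]
  rw [← Nat.multinomial_spec Finset.univ r]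
  push_cast
  ring

end HadamardProducts

end HadamardVarieties

theorem mainTheorem4_general {K : Type*} [Field K] [IsAlgClosed K]
    (n ℓ : ℕ) (h : Fin ℓ → ℕ) (hn : ∏ i, (h i + 1) ≤ n + 1) :
    HadamardVarieties.ForGenericSubspaces
      (fun L : HadamardVarieties.LinearSubspaces K n h =>
        ∀ (X : Fin ℓ → Set (HadamardVarieties.PP K n)) (r : Fin ℓ → ℕ),
          (∀ i, IsClosed (X i)) →
          (∀ i, X i ⊆ L.toSet i) →
          (∀ i, HadamardVarieties.dim (X i) = (r i : WithBot ℕ∞)) →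
            HadamardVarieties.dim (HadamardVarieties.hadamardProduct X)
                = ((∑ i, r i : ℕ) : WithBot ℕ∞) ∧
            HadamardVarieties.degree (HadamardVarieties.hadamardProduct X)
                = (Nat.multinomial Finset.univ r : ℚ) * ∏ i, HadamardVarieties.degree (X i) ∧
            ∀ m : ℕ, HadamardVarieties.hilbertFunction (HadamardVarieties.hadamardProduct X) m
                = ∏ i, HadamardVarieties.hilbertFunction (X i) m) := by
  refine ⟨_, HadamardVarieties.isZariskiOpen_independentSubspaces,
    HadamardVarieties.nonempty_independentSubspaces hn, fun L hL X r hX hXL hr => ?_⟩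
  have hH := HadamardVarieties.hilbertFunction_hadamardProduct hL hXL
  refine ⟨HadamardVarieties.dim_hadamardProduct hH hX hr, ?_, hH⟩
  exact HadamardVarieties.degree_hadamardProduct hH fun i =>
    (HadamardVarieties.dim_eq_natCast_iff (hX i)).1 (hr i)

theorem mainTheorem4 {K : Type*} [Field K] [IsAlgClosed K] [CharZero K]
    (n ℓ : ℕ) (hℓ : 0 < ℓ) (h : Fin ℓ → ℕ) (hn : ∏ i, (h i + 1) ≤ n + 1) :
    HadamardVarieties.ForGenericSubspaces
      (fun L : HadamardVarieties.LinearSubspaces K n h =>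
        ∀ (X : Fin ℓ → Set (HadamardVarieties.PP K n)) (r : Fin ℓ → ℕ),
          (∀ i, HadamardVarieties.IsSubvariety (X i)) →
          (∀ i, X i ⊆ L.toSet i) →
          (∀ i, HadamardVarieties.dim (X i) = (r i : WithBot ℕ∞)) →
            HadamardVarieties.dim (HadamardVarieties.hadamardProduct X)
                = ((∑ i, r i : ℕ) : WithBot ℕ∞) ∧
            HadamardVarieties.degree (HadamardVarieties.hadamardProduct X)
                = (Nat.multinomial Finset.univ r : ℚ) * ∏ i, HadamardVarieties.degree (X i) ∧
            ∀ m : ℕ, HadamardVarieties.hilbertFunction (HadamardVarieties.hadamardProduct X) m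
                = ∏ i, HadamardVarieties.hilbertFunction (X i) m) := by
  obtain ⟨U, hU, hne, hUX⟩ := mainTheorem4_general (K := K) n ℓ h hn
  exact ⟨U, hU, hne, fun L hL X r hX => hUX L hL X r fun i => (hX i).1⟩
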